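/- Let $p>1$, $0<h\le 1$ with $ph>1$, and let $\alpha>0$, $C_1,C_2>0$, $A_{p,h}\ge 0$. Let $(\Omega,\mathcal F,\{\mathcal F_t\}_{t\ge 0},\mathbb P)$ be a filtered probability space satisfying the usual conditions, let $T>0$, and let $\{X_t\}_{t\in[0,T]}$ be a continuous $\{\mathcal F_t\}$-adapted process with values in $\mathbb R^d$ such that $X_t\in L^p(\Omega,\mathbb R^d)$ for all $t\in[0,T]$, $$\mathbb E\big[\,|\mathbb E(X_t\mid\mathcal F_s)-X_s|^p\,\big]\le A_{p,h}\,|t-s|^{ph}\qquad\text{for all }0\le s<t\le T,$$ and $$\mathbb P(|X_t|\ge\lambda)\le C_2\exp(-C_1\lambda^\alpha)\qquad\text{for all }\lambda>0\text{ and all }t\in[0,T].$$ Then $$\mathbb P\Big(\sup_{t\in[0,T]}|X_t|\ge\lambda\Big)\le C\,\lambda^{-1/h}\exp\Big[-\frac{C_1}{2^{\alpha+2}}\Big(1-\frac1{ph}\Big)\lambda^\alpha\Big]$$ for all $\lambda\ge\lambda_0$, where the constant $C$ depends only on $(C_1,C_2,\alpha,p,h,A_{p,h})$ and the threshold $\lambda_0>0$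 depends only on these parameters and on $T$. -/

import Mathlib

open MeasureTheory
open scoped NNReal ENNReal

/-- The usual conditions on a filtered probability space `(Ω, mΩ, ℱ, μ)`: the measure is complete,
every null set belongs to `ℱ 0`, and the filtration is right-continuous. -/
structure UsualConditions {Ω : Type*} {mΩ : MeasurableSpace Ω}
    (μ : Measure Ω) (ℱ : Filtration ℝ≥0 mΩ) : Prop where
  complete : μ.IsComplete
  null_mem : ∀ s : Set Ω, μ s = 0 → MeasurableSet[ℱ 0] s
  right_cont : ∀ t : ℝ≥0, ⨅ u > t, ℱ u = ℱ t

/-- `X` is a process with time interval `[0, T]` (only the values `X t` with `t ≤ T` matter) that is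
adapted, has almost surely continuous paths on `[0, T]`, has `p`-integrable margins, and satisfies
the conditional increment control
`𝔼 |𝔼(X_t | ℱ_s) - X_s| ^ p ≤ A * |t - s| ^ (p h)` for `0 ≤ s < t ≤ T`.
The expectation of the nonnegative random variable is written as a lower Lebesgue integral. -/
structure ConditionalIncrementControl {Ω E : Type*} {mΩ : MeasurableSpace Ω}
    [NormedAddCommGroup E] [NormedSpace ℝ E] [CompleteSpace E]
    (μ : Measure Ω) (ℱ : Filtration ℝ≥0 mΩ) (T : ℝ≥0) (X : ℝ≥0 → Ω → E)
    (p h A : ℝ) : Prop where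
  adapted : ∀ t ≤ T, StronglyMeasurable[ℱ t] (X t)
  continuous_paths : ∀ᵐ ω ∂μ, ContinuousOn (fun t => X t ω) (Set.Icc 0 T)
  memLp : ∀ t ≤ T, MemLp (X t) (ENNReal.ofReal p) μ
  control : ∀ s t : ℝ≥0, s < t → t ≤ T →
    ∫⁻ ω, ‖(μ[X t | ℱ s]) ω - X s ω‖ₑ ^ p ∂μ
      ≤ ENNReal.ofReal (A * ((t : ℝ) - (s : ℝ)) ^ (p * h))

/-- Uniform `α`-exponential marginal decay on `[0, T]` with constants `C₁`, `C₂`. -/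
def UniformExpMarginalDecay {Ω E : Type*} {mΩ : MeasurableSpace Ω} [NormedAddCommGroup E]
    (μ : Measure Ω) (T : ℝ≥0) (X : ℝ≥0 → Ω → E) (α C₁ C₂ : ℝ) : Prop :=
  ∀ lam : ℝ, 0 < lam → ∀ t ≤ T,
    μ.real {ω | lam ≤ ‖X t ω‖} ≤ C₂ * Real.exp (-C₁ * lam ^ α)

/-! Only conditional increments are controlled, so pathwise chaining is unavailable. Instead, a new
midpoint value is compared with the conditional expectation of its right neighbour. Inductively,
every grid value is dominated by `μ[S N | ℱ t]` for a single variable `S N`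
(`norm_le_condExp_of_grid`), and Doob's weak inequality bounds the maximum.

`S N` is a constant plus the excesses over a level `c` at `n + 1` base points and weighted `p`-th
powers of the increments. The excesses cost about `n * exp (-(C₁ / 2) * c ^ α)`
(`integral_max_norm_sub_le`), the increments `n ^ (1 - p * h)` (`sum_weight_mul_le`). Balancing `n`
with `c = lam / 2` gives twice the claimed exponential rate; the spare half absorbs `lam ^ (1 / h)`
and all constants, including those depending on `T`. -/

/-! ### Chaining through conditional expectations, and Doob's inequality. -/

/-- Chaining for processes controlled through conditional increments along a refining grid `τ`:
the process at the grid points is dominated by the conditional expectations of `S`. -/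
lemma norm_le_condExp_of_grid {Ω E : Type*} {mΩ : MeasurableSpace Ω}
    [NormedAddCommGroup E] [NormedSpace ℝ E] [CompleteSpace E]
    {μ : Measure Ω} [IsFiniteMeasure μ] {ℱ : Filtration ℝ≥0 mΩ} {X : ℝ≥0 → Ω → E}
    {τ : ℕ → ℕ → ℝ≥0} {n : ℕ} {S : ℕ → Ω → ℝ}
    (hmono : ∀ N, Monotone (τ N)) (hrefine : ∀ N j, τ (N + 1) (2 * j) = τ N j)
    (hadapted : ∀ N, ∀ j ≤ n * 2 ^ N, StronglyMeasurable[ℱ (τ N j)] (X (τ N j)))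
    (hX : ∀ N, ∀ j ≤ n * 2 ^ N, Integrable (X (τ N j)) μ)
    (hS : ∀ N, Integrable (S N) μ)
    (hbase : ∀ j ≤ n, ∀ ω, ‖X (τ 0 j) ω‖ ≤ S 0 ω)
    (hstep : ∀ N, ∀ j < n * 2 ^ (N + 1), ∀ ω,
      S N ω + ‖(μ[X (τ (N + 1) (j + 1)) | ℱ (τ (N + 1) j)]) ω - X (τ (N + 1) j) ω‖ ≤ S (N + 1) ω)
    (hS_mono : ∀ N, S N ≤ S (N + 1)) (N : ℕ) :
    ∀ j ≤ n * 2 ^ N, ∀ᵐ ω ∂μ, ‖X (τ N j) ω‖ ≤ (μ[S N | ℱ (τ N j)]) ω := by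
  induction N with
  | zero =>
    intro j hj
    have h1 := condExp_mono (m := ℱ (τ 0 j)) (hX 0 j hj).norm (hS 0)
      (Filter.Eventually.of_forall (hbase j (by simpa using hj)))
    rw [condExp_of_stronglyMeasurable (ℱ.le _) (hadapted 0 j hj).norm (hX 0 j hj).norm] at h1
    exact h1
  | succ N ih =>
    intro j hj
    rcases Nat.even_or_odd' j with ⟨k, rfl | rfl⟩
    · rw [hrefine]
      have hk : k ≤ n * 2 ^ N := by rw [pow_succ] at hj; lia
      have h1 := condExp_mono (m := ℱ (τ N k)) (hS N) (hS (N + 1))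
        (Filter.Eventually.of_forall (hS_mono N))
      filter_upwards [ih k hk, h1] with ω h2 h3 using h2.trans h3
    -- An odd index is a new midpoint `u`. Its right neighbour `v` lies on the coarser grid and in
    -- the future, so the induction hypothesis at `v` can be conditioned down to `ℱ u` by the tower
    -- property.
    · set u := τ (N + 1) (2 * k + 1) with hu
      have hk : k + 1 ≤ n * 2 ^ N := by rw [pow_succ] at hj; lia
      have hv : τ (N + 1) (2 * k + 1 + 1) = τ N (k + 1) := hrefine N (k + 1)
      have huv : u ≤ τ N (k + 1) := hv ▸ hmono (N + 1) (Nat.le_succ _)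
      set v := τ N (k + 1) with hv'
      set ξ : Ω → E := fun ω => (μ[X v | ℱ u]) ω - X u ω with hξ
      have hξm : StronglyMeasurable[ℱ u] ξ :=
        stronglyMeasurable_condExp.sub (hadapted (N + 1) _ hj)
      have hξi : Integrable ξ μ := integrable_condExp.sub (hX (N + 1) _ hj)
      have h1 : ∀ᵐ ω ∂μ, ‖(μ[X v | ℱ u]) ω‖ ≤ (μ[fun ω => ‖X v ω‖ | ℱ u]) ω :=
        norm_condExp_le (X v)
      have h2 := condExp_mono (m := ℱ u) (hX N _ hk).norm
        (integrable_condExp (μ := μ) (m := ℱ v) (f := S N)) (ih _ hk)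
      have h3 : μ[μ[S N | ℱ v] | ℱ u] =ᵐ[μ] μ[S N | ℱ u] :=
        condExp_condExp_of_le (ℱ.mono huv) (ℱ.le v)
      have h4 := condExp_mono (m := ℱ u) ((hS N).add hξi.norm) (hS (N + 1))
        (Filter.Eventually.of_forall (fun ω => by
          have := hstep N (2 * k + 1) (by rw [pow_succ] at hj ⊢; lia) ω
          rw [hv] at this
          exact this))
      have h5 := condExp_add (hS N) hξi.norm (ℱ u)
      rw [condExp_of_stronglyMeasurable (ℱ.le _) hξm.norm hξi.norm] at h5
      filter_upwards [h1, h2, h3, h4, h5] with ω h1 h2 h3 h4 h5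
      rw [h3] at h2
      rw [h5] at h4
      have h6 : ‖X u ω‖ ≤ ‖(μ[X v | ℱ u]) ω‖ + ‖ξ ω‖ := by
        have : X u ω = (μ[X v | ℱ u]) ω - ξ ω := by simp [hξ]
        rw [this]; exact norm_sub_le _ _
      simp only [Pi.add_apply] at h4
      linarith

/-- Doob's weak-type maximal inequality for the martingale closed by a nonnegative variable. -/
lemma measure_exists_le_condExp {Ω : Type*} {mΩ : MeasurableSpace Ω} {μ : Measure Ω}
    [IsFiniteMeasure μ] (𝒢 : Filtration ℕ mΩ) {V : Ω → ℝ} (hV : 0 ≤ V)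
    {ε : ℝ} (hε : 0 < ε) (m : ℕ) :
    μ {ω | ∃ k ≤ m, ε ≤ (μ[V | 𝒢 k]) ω} ≤ ENNReal.ofReal ((∫ ω, V ω ∂μ) / ε) := by
  -- `maximal_ineq` needs pointwise nonnegativity, while the conditional expectations are
  -- nonnegative only almost everywhere; hence the positive part.
  have hsub : Submartingale (fun k => μ[V | 𝒢 k])⁺ 𝒢 μ := (martingale_condExp V 𝒢 μ).submartingale.pos
  lift ε to ℝ≥0 using hε.le
  have key := maximal_ineq hsub (fun k ω => by simp) (ε := ε) m
  have h0 : 0 ≤ᵐ[μ] μ[V | 𝒢 m] := condExp_nonneg (Filter.Eventually.of_forall hV)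
  have h1 : ∫ ω, ((fun k => μ[V | 𝒢 k])⁺) m ω ∂μ = ∫ ω, V ω ∂μ := by
    rw [← integral_condExp (𝒢.le m) (f := V)]
    refine integral_congr_ae ?_
    filter_upwards [h0] with ω hω
    simpa using hω
  have h2 : ε * μ {ω | ∃ k ≤ m, (ε : ℝ) ≤ (μ[V | 𝒢 k]) ω} ≤ ENNReal.ofReal (∫ ω, V ω ∂μ) := by
    refine le_trans ?_ (key.trans (ENNReal.ofReal_le_ofReal ?_))
    · gcongr
      rename_i ω
      rintro ⟨k, hk, hkω⟩
      exact hkω.trans (le_trans (le_posPart _) (Finset.le_sup' (fun k => ((fun k => μ[V | 𝒢 k])⁺) k ω)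
        (Finset.mem_range.2 (Nat.lt_succ_of_le hk))))
    · rw [← h1]
      exact setIntegral_le_integral (hsub.integrable m)
        (Filter.Eventually.of_forall fun ω => by simp)
  rw [ENNReal.ofReal_div_of_pos hε, ENNReal.le_div_iff_mul_le (Or.inl (by simpa using hε.ne'))
    (by simp), mul_comm]
  simpa using h2

/-! ### Elementary, tail and moment estimates. -/

/-- Trades an increment for a deterministic allowance `c` plus a `p`-th power, whose mean the
hypotheses control. -/
lemma le_add_rpow_mul_rpow {p c x : ℝ} (hp : 1 ≤ p) (hc : 0 < c) (hx : 0 ≤ x) :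
    x ≤ c + c ^ (1 - p) * x ^ p := by
  rcases le_total x c with h | h
  · have : 0 ≤ c ^ (1 - p) * x ^ p := by positivity
    linarith
  · have hx0 : 0 < x := hc.trans_le h
    have h1 : x = x ^ (1 - p) * x ^ p := by
      rw [← Real.rpow_add hx0]; simp
    have h2 : x ^ (1 - p) ≤ c ^ (1 - p) := Real.rpow_le_rpow_of_nonpos hc h (by linarith)
    have h3 : x ^ (1 - p) * x ^ p ≤ c ^ (1 - p) * x ^ p := by gcongr
    linarith

/-- Layer-cake bound for the excess of a variable with exponentially decaying tail. -/
lemma integral_max_norm_sub_le {Ω E : Type*} {mΩ : MeasurableSpace Ω} {μ : Measure Ω}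
    [IsFiniteMeasure μ] [NormedAddCommGroup E] {Y : Ω → E} (hY : Integrable Y μ)
    {α C₁ C₂ : ℝ} (hα : 0 < α) (hC₁ : 0 < C₁) (hC₂ : 0 ≤ C₂)
    (htail : ∀ r : ℝ, 0 < r → μ.real {ω | r ≤ ‖Y ω‖} ≤ C₂ * Real.exp (-C₁ * r ^ α))
    {c : ℝ} (hc : 0 ≤ c) :
    ∫ ω, max (‖Y ω‖ - c) 0 ∂μ ≤
      (C₂ * ∫ t in Set.Ioi (0 : ℝ), Real.exp (-(C₁ / 2) * t ^ α)) *
        Real.exp (-(C₁ / 2) * c ^ α) := by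
  have hint : Integrable (fun ω => max (‖Y ω‖ - c) 0) μ :=
    (hY.norm.sub (integrable_const c)).pos_part
  have hexp : IntegrableOn (fun t : ℝ => Real.exp (-(C₁ / 2) * t ^ α)) (Set.Ioi 0) := by
    simpa using integrableOn_rpow_mul_exp_neg_mul_rpow (s := 0) (by norm_num) hα (half_pos hC₁)
  have hnn : 0 ≤ᵐ[μ] fun ω => max (‖Y ω‖ - c) 0 :=
    Filter.Eventually.of_forall fun ω => le_max_right _ _
  rw [hint.integral_eq_integral_meas_le hnn, ← integral_const_mul, ← integral_mul_const]
  refine integral_mono_of_nonneg (Filter.Eventually.of_forall fun _ => measureReal_nonneg)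
    ((hexp.const_mul _).mul_const _) (ae_restrict_of_forall_mem measurableSet_Ioi ?_)
  intro t ht
  have ht : 0 < t := ht
  have hset : {ω | t ≤ max (‖Y ω‖ - c) 0} = {ω | t + c ≤ ‖Y ω‖} := by
    ext ω
    simp only [Set.mem_ofPred_eq, le_max_iff, not_le.2 ht, or_false]
    constructor <;> intro h <;> linarith
  dsimp only
  rw [hset, mul_assoc, ← Real.exp_add]
  refine (htail _ (by linarith)).trans ?_
  -- Half of the rate `C₁` goes to integrability in `t`, the other half to decay in `c`; this works
  -- for every `α > 0`.
  have h1 : t ^ α ≤ (t + c) ^ α := Real.rpow_le_rpow ht.le (by linarith) hα.le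
  have h2 : c ^ α ≤ (t + c) ^ α := Real.rpow_le_rpow hc (by linarith) hα.le
  gcongr
  nlinarith

lemma integral_norm_rpow_le_of_lintegral_le {Ω E : Type*} {mΩ : MeasurableSpace Ω} {μ : Measure Ω}
    [NormedAddCommGroup E] {Y : Ω → E} (hY : AEStronglyMeasurable Y μ) {p B : ℝ} (hp : 0 < p)
    (hB : 0 ≤ B) (h : ∫⁻ ω, ‖Y ω‖ₑ ^ p ∂μ ≤ ENNReal.ofReal B) :
    Integrable (fun ω => ‖Y ω‖ ^ p) μ ∧ ∫ ω, ‖Y ω‖ ^ p ∂μ ≤ B := by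
  have hm : AEStronglyMeasurable (fun ω => ‖Y ω‖ ^ p) μ :=
    (Real.continuous_rpow_const hp.le).comp_aestronglyMeasurable hY.norm
  have hof : ∀ ω, ENNReal.ofReal (‖Y ω‖ ^ p) = ‖Y ω‖ₑ ^ p := fun ω => by
    rw [← ENNReal.ofReal_rpow_of_nonneg (norm_nonneg _) hp.le, ofReal_norm]
  have hnn : 0 ≤ᵐ[μ] fun ω => ‖Y ω‖ ^ p := Filter.Eventually.of_forall fun ω => by positivity
  constructor
  · refine ⟨hm, (hasFiniteIntegral_iff_ofReal hnn).2 ?_⟩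
    simp_rw [hof]
    exact h.trans_lt ENNReal.ofReal_lt_top
  · rw [integral_eq_lintegral_of_nonneg_ae hnn hm]
    simp_rw [hof]
    exact ENNReal.toReal_le_of_le_ofReal hB h

/-! ### Uniform grids and their dyadic refinements. -/

/-- The `j`-th point of the uniform grid of `[0, T]` with mesh `T / (n * 2 ^ N)`. -/
noncomputable def gridPoint (T : ℝ≥0) (n N j : ℕ) : ℝ≥0 := T * (j / (n * 2 ^ N))

namespace gridPoint

variable {T : ℝ≥0} {n : ℕ}

lemma monotone (N : ℕ) : Monotone (gridPoint T n N) := by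
  intro i j hij
  unfold gridPoint
  gcongr

lemma succ_two_mul (N j : ℕ) : gridPoint T n (N + 1) (2 * j) = gridPoint T n N j := by
  unfold gridPoint
  rw [pow_succ, mul_comm ((2 : ℝ≥0) ^ N) 2, mul_left_comm]
  push_cast
  rw [mul_div_mul_left _ _ two_ne_zero]

lemma le {N j : ℕ} (hj : j ≤ n * 2 ^ N) : gridPoint T n N j ≤ T := by
  unfold gridPoint
  refine mul_le_of_le_one_right' (div_le_one_of_le₀ ?_ (by positivity))
  exact_mod_cast hj

lemma succ_sub (N j : ℕ) :
    (gridPoint T n N (j + 1) : ℝ) - (gridPoint T n N j : ℝ) = T / (n * 2 ^ N) := by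
  unfold gridPoint
  push_cast
  ring

lemma lt_succ (hT : 0 < T) (hn : 0 < n) (N j : ℕ) :
    gridPoint T n N j < gridPoint T n N (j + 1) := by
  have h := succ_sub (T := T) (n := n) N j
  have : (0 : ℝ) < T / (n * 2 ^ N) := by positivity
  rw [← NNReal.coe_lt_coe]
  linarith

/-- Grid points approximate every time in `[0, T]`. -/
lemma exists_abs_sub_lt (hT : 0 < T) (hn : 0 < n) {t : ℝ≥0} (ht : t ≤ T) {δ : ℝ} (hδ : 0 < δ) :
    ∃ N, ∃ j ≤ n * 2 ^ N, |(gridPoint T n N j : ℝ) - t| < δ := by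
  obtain ⟨N, hN⟩ := exists_nat_gt ((T : ℝ) / δ)
  have hT' : (0 : ℝ) < T := hT
  have ht' : (t : ℝ) ≤ T := ht
  have hn' : (1 : ℝ) ≤ n := by exact_mod_cast hn
  have h2 : (N : ℝ) < 2 ^ N := by exact_mod_cast Nat.lt_two_pow_self
  set M : ℝ := n * 2 ^ N with hM
  have hMN : (N : ℝ) < M := by nlinarith
  have hMpos : 0 < M := by positivity
  have h3 := Nat.floor_le (a := (t : ℝ) * M / T) (by positivity)
  have h4 := Nat.lt_floor_add_one ((t : ℝ) * M / T)
  set j := ⌊(t : ℝ) * M / T⌋₊ with hj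
  refine ⟨N, j, ?_, ?_⟩
  · have : (j : ℝ) ≤ n * 2 ^ N := h3.trans (by
      rw [div_le_iff₀ hT', ← hM, mul_comm]; gcongr)
    exact_mod_cast this
  · have hg : (gridPoint T n N j : ℝ) = T * (j / M) := by simp [gridPoint, hM]
    rw [le_div_iff₀ hT'] at h3
    rw [div_lt_iff₀ hT'] at h4
    rw [div_lt_iff₀ hδ] at hN
    have h5 : (gridPoint T n N j : ℝ) * M = j * T := by rw [hg]; field_simp
    have h6 : (T : ℝ) < M * δ := by nlinarith
    rw [abs_lt]
    constructor <;> refine lt_of_mul_lt_mul_right (a := M) ?_ hMpos.le <;> nlinarith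

/-- The excess over a level on a continuous path is detected by the grids. -/
lemma exists_le_norm {E : Type*} [NormedAddCommGroup E] (hT : 0 < T) (hn : 0 < n) {f : ℝ≥0 → E}
    (hf : ContinuousOn f (Set.Icc 0 T)) {r lam : ℝ} (hr0 : 0 ≤ r) (hr : r < lam)
    (hsup : ENNReal.ofReal lam ≤ ⨆ t ∈ Set.Icc (0 : ℝ≥0) T, ‖f t‖ₑ) :
    ∃ N, ∃ j ≤ n * 2 ^ N, r ≤ ‖f (gridPoint T n N j)‖ := by
  have h1 : ENNReal.ofReal r < ⨆ t ∈ Set.Icc (0 : ℝ≥0) T, ‖f t‖ₑ :=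
    ((ENNReal.ofReal_lt_ofReal_iff (hr0.trans_lt hr)).2 hr).trans_le hsup
  simp only [lt_iSup_iff] at h1
  obtain ⟨t, ht, hrt⟩ := h1
  rw [← ofReal_norm, ENNReal.ofReal_lt_ofReal_iff_of_nonneg hr0] at hrt
  have h2 := (hf.norm t ht).eventually (lt_mem_nhds hrt)
  obtain ⟨δ, hδ, h3⟩ := Metric.mem_nhdsWithin_iff.1 h2
  obtain ⟨N, j, hj, hlt⟩ := exists_abs_sub_lt hT hn ht.2 hδ
  refine ⟨N, j, hj, le_of_lt (h3 ⟨?_, zero_le, le hj⟩)⟩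
  rwa [Metric.mem_ball, NNReal.dist_eq]

lemma exists_le_norm_mono {E : Type*} [NormedAddCommGroup E] {f : ℝ≥0 → E} {r : ℝ} {N : ℕ}
    (h : ∃ j ≤ n * 2 ^ N, r ≤ ‖f (gridPoint T n N j)‖) :
    ∃ j ≤ n * 2 ^ (N + 1), r ≤ ‖f (gridPoint T n (N + 1) j)‖ := by
  obtain ⟨j, hj, hr⟩ := h
  exact ⟨2 * j, by rw [pow_succ]; lia, by rwa [succ_two_mul]⟩

end gridPoint

/-! ### The maximal inequality on grids. -/

section MaximalBound

variable {Ω E : Type*} {mΩ : MeasurableSpace Ω} [NormedAddCommGroup E] [NormedSpace ℝ E]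

/-- The increment over the `j`-th cell of the grid of level `N`, conditioned on its left end. -/
noncomputable def gridIncrement (μ : Measure Ω) (ℱ : Filtration ℝ≥0 mΩ) (T : ℝ≥0)
    (X : ℝ≥0 → Ω → E) (n N j : ℕ) (ω : Ω) : E :=
  (μ[X (gridPoint T n N (j + 1)) | ℱ (gridPoint T n N j)]) ω - X (gridPoint T n N j) ω

/-- The truncation error of the grid values at level `c`, together with the weighted conditional
increments of the refinements up to level `N`. -/
noncomputable def chainingError (μ : Measure Ω) (ℱ : Filtration ℝ≥0 mΩ) (T : ℝ≥0)
    (X : ℝ≥0 → Ω → E) (p c : ℝ) (w : ℕ → ℝ) (n N : ℕ) (ω : Ω) : ℝ :=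
  ∑ i ∈ Finset.range (n + 1), max (‖X (gridPoint T n 0 i) ω‖ - c) 0 +
    ∑ m ∈ Finset.range N, w m ^ (1 - p) *
      ∑ j ∈ Finset.range (n * 2 ^ (m + 1)), ‖gridIncrement μ ℱ T X n (m + 1) j ω‖ ^ p

variable {μ : Measure Ω} {ℱ : Filtration ℝ≥0 mΩ} {T : ℝ≥0}
  {X : ℝ≥0 → Ω → E} {p h A : ℝ}

lemma chainingError_nonneg {c : ℝ} {w : ℕ → ℝ} (hw : ∀ m, 0 < w m) (n N : ℕ) :
    0 ≤ chainingError μ ℱ T X p c w n N := by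
  intro ω
  refine add_nonneg (Finset.sum_nonneg fun i _ => le_max_right _ _)
    (Finset.sum_nonneg fun m _ => mul_nonneg (Real.rpow_nonneg (hw m).le _)
      (Finset.sum_nonneg fun j _ => Real.rpow_nonneg (norm_nonneg _) _))

variable [CompleteSpace E]

/-- Letting the grids refine, the maximum over the grid becomes the supremum over `[0, T]`. -/
lemma ConditionalIncrementControl.measure_iSup_le
    (hX : ConditionalIncrementControl μ ℱ T X p h A) (hT : 0 < T) {n : ℕ} (hn : 0 < n)
    {r lam : ℝ} (hr0 : 0 ≤ r) (hr : r < lam) {B : ℝ≥0∞}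
    (hB : ∀ N, μ {ω | ∃ j ≤ n * 2 ^ N, r ≤ ‖X (gridPoint T n N j) ω‖} ≤ B) :
    μ {ω | ENNReal.ofReal lam ≤ ⨆ t ∈ Set.Icc (0 : ℝ≥0) T, ‖X t ω‖ₑ} ≤ B := by
  set D : ℕ → Set Ω := fun N => {ω | ∃ j ≤ n * 2 ^ N, r ≤ ‖X (gridPoint T n N j) ω‖}
  have hmono : Monotone D := monotone_nat_of_le_succ fun N ω hω =>
    gridPoint.exists_le_norm_mono (f := fun t => X t ω) hω
  calc _ ≤ μ (⋃ N, D N) := by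
        refine measure_mono_ae ?_
        filter_upwards [hX.continuous_paths] with ω hω hsup
        exact Set.mem_iUnion.2 (gridPoint.exists_le_norm hT hn hω hr0 hr hsup)
    _ = ⨆ N, μ (D N) := hmono.measure_iUnion
    _ ≤ B := iSup_le hB

variable [IsProbabilityMeasure μ]

lemma ConditionalIncrementControl.integrable (hX : ConditionalIncrementControl μ ℱ T X p h A)
    (hp : 1 ≤ p) {t : ℝ≥0} (ht : t ≤ T) : Integrable (X t) μ :=
  (hX.memLp t ht).integrable (by simpa using ENNReal.ofReal_le_ofReal hp)

lemma ConditionalIncrementControl.integral_gridIncrement_le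
    (hX : ConditionalIncrementControl μ ℱ T X p h A) (hp : 1 ≤ p) (hA : 0 ≤ A) (hT : 0 < T)
    {n N j : ℕ} (hn : 0 < n) (hj : j < n * 2 ^ N) :
    Integrable (fun ω => ‖gridIncrement μ ℱ T X n N j ω‖ ^ p) μ ∧
      ∫ ω, ‖gridIncrement μ ℱ T X n N j ω‖ ^ p ∂μ ≤ A * (T / (n * 2 ^ N)) ^ (p * h) := by
  have hc := hX.control _ _ (gridPoint.lt_succ hT hn N j) (gridPoint.le (Nat.succ_le_of_lt hj))
  rw [gridPoint.succ_sub] at hc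
  refine integral_norm_rpow_le_of_lintegral_le ?_ (by linarith) (by positivity) hc
  exact (integrable_condExp.sub (hX.integrable hp (gridPoint.le hj.le))).aestronglyMeasurable

lemma ConditionalIncrementControl.integrable_chainingError
    (hX : ConditionalIncrementControl μ ℱ T X p h A) (hp : 1 ≤ p) (hA : 0 ≤ A) (hT : 0 < T)
    {n : ℕ} (hn : 0 < n) (c : ℝ) (w : ℕ → ℝ) (N : ℕ) :
    Integrable (chainingError μ ℱ T X p c w n N) μ := by
  refine Integrable.add (integrable_finsetSum _ fun i hi => ?_)
    (integrable_finsetSum _ fun m _ => Integrable.const_mul (integrable_finsetSum _ fun j hj => ?_) _)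
  · refine (Integrable.sub (Integrable.norm (hX.integrable hp (gridPoint.le ?_)))
      (integrable_const c)).pos_part
    simpa using Nat.le_of_lt_succ (Finset.mem_range.1 hi)
  · exact (hX.integral_gridIncrement_le hp hA hT hn (Finset.mem_range.1 hj)).1

/-- The level `c` and the weights are deterministic, so they pass through the conditional
expectation and use up at most `c + d` of the threshold. Doob's inequality is then needed only for
`chainingError` at height `ε`. -/
lemma ConditionalIncrementControl.measure_grid_le
    (hX : ConditionalIncrementControl μ ℱ T X p h A) (hp : 1 ≤ p) (hA : 0 ≤ A) (hT : 0 < T)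
    {n : ℕ} (hn : 0 < n) {c d ε : ℝ} {w : ℕ → ℝ} (hw : ∀ m, 0 < w m)
    (hd : ∀ N, ∑ m ∈ Finset.range N, w m ≤ d) (hε : 0 < ε) (N : ℕ) :
    μ {ω | ∃ j ≤ n * 2 ^ N, c + d + ε ≤ ‖X (gridPoint T n N j) ω‖} ≤
      ENNReal.ofReal ((∫ ω, chainingError μ ℱ T X p c w n N ω ∂μ) / ε) := by
  have hVint := hX.integrable_chainingError hp hA hT hn c w
  set S : ℕ → Ω → ℝ := fun N ω =>
    (c + ∑ m ∈ Finset.range N, w m) + chainingError μ ℱ T X p c w n N ω with hS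
  have hSsucc : ∀ N ω, S (N + 1) ω = S N ω + (w N + w N ^ (1 - p) *
      ∑ j ∈ Finset.range (n * 2 ^ (N + 1)), ‖gridIncrement μ ℱ T X n (N + 1) j ω‖ ^ p) := by
    intro N ω
    simp only [hS, chainingError, Finset.sum_range_succ _ N]
    ring
  have hchain := norm_le_condExp_of_grid (μ := μ) (ℱ := ℱ) (X := X) (τ := gridPoint T n) (n := n)
    (S := S) gridPoint.monotone gridPoint.succ_two_mul
    (fun N j hj => hX.adapted _ (gridPoint.le hj))
    (fun N j hj => hX.integrable hp (gridPoint.le hj))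
    (fun N => (integrable_const _).add (hVint N))
    (fun j hj ω => by
      have h1 : max (‖X (gridPoint T n 0 j) ω‖ - c) 0 ≤
          ∑ i ∈ Finset.range (n + 1), max (‖X (gridPoint T n 0 i) ω‖ - c) 0 :=
        Finset.single_le_sum (f := fun i => max (‖X (gridPoint T n 0 i) ω‖ - c) 0)
          (fun i _ => le_max_right _ _) (Finset.mem_range.2 (Nat.lt_succ_of_le hj))
      have h2 := le_max_left (‖X (gridPoint T n 0 j) ω‖ - c) 0
      simp only [hS, chainingError, Finset.range_zero, Finset.sum_empty, add_zero]
      linarith)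
    (fun N j hj ω => by
      rw [hSsucc]
      have h1 := le_add_rpow_mul_rpow hp (hw N) (norm_nonneg (gridIncrement μ ℱ T X n (N + 1) j ω))
      have h2 : ‖gridIncrement μ ℱ T X n (N + 1) j ω‖ ^ p ≤ _ :=
        Finset.single_le_sum (f := fun j => ‖gridIncrement μ ℱ T X n (N + 1) j ω‖ ^ p)
          (fun i _ => Real.rpow_nonneg (norm_nonneg _) _) (Finset.mem_range.2 hj)
      have h3 := mul_le_mul_of_nonneg_left h2 (Real.rpow_nonneg (hw N).le (1 - p))
      unfold gridIncrement at *
      linarith)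
    (fun N ω => by
      rw [hSsucc]
      have := hw N
      have : 0 ≤ ∑ j ∈ Finset.range (n * 2 ^ (N + 1)),
          ‖gridIncrement μ ℱ T X n (N + 1) j ω‖ ^ p :=
        Finset.sum_nonneg fun j _ => Real.rpow_nonneg (norm_nonneg _) _
      have := mul_nonneg (Real.rpow_nonneg (hw N).le (1 - p)) this
      linarith) N
  let 𝒢 : Filtration ℕ mΩ :=
    { seq := fun j => ℱ (gridPoint T n N j)
      mono' := fun i j hij => ℱ.mono (gridPoint.monotone N hij)
      le' := fun j => ℱ.le _ }
  refine le_trans (measure_mono_ae ?_)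
    (measure_exists_le_condExp 𝒢 (chainingError_nonneg hw n N) hε (n * 2 ^ N))
  have hadd : ∀ j, μ[S N | 𝒢 j] =ᵐ[μ] fun ω => (c + ∑ m ∈ Finset.range N, w m) +
      (μ[chainingError μ ℱ T X p c w n N | 𝒢 j]) ω := by
    intro j
    have h1 := condExp_add (integrable_const (μ := μ) (c + ∑ m ∈ Finset.range N, w m)) (hVint N) (𝒢 j)
    rw [condExp_const (𝒢.le j)] at h1
    exact h1
  have hchain' : ∀ᵐ ω ∂μ, ∀ j ≤ n * 2 ^ N, ‖X (gridPoint T n N j) ω‖ ≤ (μ[S N | 𝒢 j]) ω :=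
    ae_all_iff.2 fun j => by
      by_cases hj : j ≤ n * 2 ^ N
      · filter_upwards [hchain j hj] with ω hω _ using hω
      · exact Filter.Eventually.of_forall fun ω h => absurd h hj
  filter_upwards [hchain', ae_all_iff.2 hadd] with ω h1 h2 ⟨j, hj, hle⟩
  refine ⟨j, hj, ?_⟩
  have h3 := h1 j hj
  rw [h2 j] at h3
  have := hd N
  linarith

lemma ConditionalIncrementControl.integral_chainingError_le
    (hX : ConditionalIncrementControl μ ℱ T X p h A) (hp : 1 ≤ p) (hA : 0 ≤ A) (hT : 0 < T)
    {n : ℕ} (hn : 0 < n) {c K : ℝ} {w : ℕ → ℝ} (hw : ∀ m, 0 < w m)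
    (hK : ∀ t ≤ T, ∫ ω, max (‖X t ω‖ - c) 0 ∂μ ≤ K) (N : ℕ) :
    ∫ ω, chainingError μ ℱ T X p c w n N ω ∂μ ≤ (n + 1) * K +
      ∑ m ∈ Finset.range N, w m ^ (1 - p) *
        ((n * 2 ^ (m + 1)) * (A * (T / (n * 2 ^ (m + 1))) ^ (p * h))) := by
  have h1 : ∀ i ∈ Finset.range (n + 1), gridPoint T n 0 i ≤ T := fun i hi =>
    gridPoint.le (by simpa using Nat.le_of_lt_succ (Finset.mem_range.1 hi))
  have hi1 : ∀ i ∈ Finset.range (n + 1),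
      Integrable (fun ω => max (‖X (gridPoint T n 0 i) ω‖ - c) 0) μ := fun i hi =>
    ((hX.integrable hp (h1 i hi)).norm.sub (integrable_const c)).pos_part
  have hi2 : ∀ m, ∀ j ∈ Finset.range (n * 2 ^ (m + 1)),
      Integrable (fun ω => ‖gridIncrement μ ℱ T X n (m + 1) j ω‖ ^ p) μ := fun m j hj =>
    (hX.integral_gridIncrement_le hp hA hT hn (Finset.mem_range.1 hj)).1
  unfold chainingError
  rw [integral_add (integrable_finsetSum _ hi1) (integrable_finsetSum _ fun m _ =>
      (integrable_finsetSum _ (hi2 m)).const_mul _), integral_finsetSum _ hi1,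
    integral_finsetSum _ fun m _ => (integrable_finsetSum _ (hi2 m)).const_mul _]
  refine add_le_add ?_ (Finset.sum_le_sum fun m _ => ?_)
  · refine (Finset.sum_le_card_nsmul _ _ K fun i hi => hK _ (h1 i hi)).trans (le_of_eq ?_)
    simp
  · rw [integral_const_mul, integral_finsetSum _ (hi2 m)]
    refine mul_le_mul_of_nonneg_left ?_ (Real.rpow_nonneg (hw m).le _)
    refine (Finset.sum_le_card_nsmul _ _ _ fun j hj =>
      (hX.integral_gridIncrement_le hp hA hT hn (Finset.mem_range.1 hj)).2).trans (le_of_eq ?_)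
    simp

end MaximalBound

/-! ### Geometric weights and the bound for a fixed number of cells. -/

lemma sum_range_mul_one_sub_mul_pow_le {ρ a : ℝ} (hρ0 : 0 ≤ ρ) (ha : 0 ≤ a) (N : ℕ) :
    ∑ m ∈ Finset.range N, a * (1 - ρ) * ρ ^ m ≤ a := by
  rw [← Finset.mul_sum, mul_assoc, mul_neg_geom_sum]
  have : 0 ≤ ρ ^ N := by positivity
  nlinarith

/-- With geometric weights of ratio `ρ`, `ρ ^ p = 2 ^ (1 - p h)`, the weighted conditional
increments of all levels are summable, uniformly in the number `n` of initial cells up to the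
factor `n ^ (1 - p h)`. -/
lemma sum_weight_mul_le {p h A T a ρ : ℝ} (hp : 1 ≤ p) (hA : 0 ≤ A) (hT : 0 ≤ T) (ha : 1 ≤ a)
    (hρ0 : 0 < ρ) (hρ1 : ρ < 1) (hρ : ρ ^ p = 2 ^ (1 - p * h)) {n : ℕ} (hn : 0 < n) (N : ℕ) :
    ∑ m ∈ Finset.range N, (a * (1 - ρ) * ρ ^ m) ^ (1 - p) *
        ((n * 2 ^ (m + 1)) * (A * (T / (n * 2 ^ (m + 1))) ^ (p * h))) ≤
      A * T ^ (p * h) * ((1 - ρ) ^ (1 - p) * (1 - ρ)⁻¹) * (n : ℝ) ^ (1 - p * h) := by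
  have hs : 0 < 1 - ρ := by linarith
  have hn' : (0 : ℝ) < n := by exact_mod_cast hn
  have hterm : ∀ m : ℕ, (a * (1 - ρ) * ρ ^ m) ^ (1 - p) *
        ((n * 2 ^ (m + 1)) * (A * (T / (n * 2 ^ (m + 1))) ^ (p * h))) ≤
      A * T ^ (p * h) * (1 - ρ) ^ (1 - p) * (n : ℝ) ^ (1 - p * h) * ρ ^ m := by
    intro m
    have hρm : 0 < ρ ^ m := by positivity
    have h1 : (a * (1 - ρ) * ρ ^ m) ^ (1 - p) ≤ (1 - ρ) ^ (1 - p) * (ρ ^ m) ^ (1 - p) := by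
      rw [← Real.mul_rpow hs.le hρm.le]
      refine Real.rpow_le_rpow_of_nonpos (by positivity) ?_ (by linarith)
      rw [mul_assoc]
      exact le_mul_of_one_le_left (by positivity) ha
    have h2 : ((n : ℝ) * 2 ^ (m + 1)) * (T / (n * 2 ^ (m + 1))) ^ (p * h) =
        T ^ (p * h) * (n : ℝ) ^ (1 - p * h) * (ρ ^ (m + 1)) ^ p := by
      have h3 : (ρ ^ (m + 1)) ^ p = ((2 : ℝ) ^ (m + 1)) ^ (1 - p * h) := by
        rw [← Real.rpow_natCast ρ, ← Real.rpow_mul hρ0.le, mul_comm, Real.rpow_mul hρ0.le, hρ,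
          ← Real.rpow_mul two_pos.le, mul_comm, Real.rpow_mul two_pos.le, Real.rpow_natCast]
      have hM : (0 : ℝ) < n * 2 ^ (m + 1) := by positivity
      rw [h3, mul_assoc (T ^ (p * h)), ← Real.mul_rpow hn'.le (by positivity), Real.div_rpow hT hM.le,
        Real.rpow_sub hM, Real.rpow_one]
      ring
    -- Giving up one factor `ρ` lets the exponents `1 - p` and `p` add to `1`, leaving a geometric
    -- series.
    have h4 : (ρ ^ (m + 1)) ^ p ≤ (ρ ^ m) ^ p := by
      refine Real.rpow_le_rpow (by positivity) ?_ (by linarith)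
      exact pow_le_pow_of_le_one hρ0.le hρ1.le (Nat.le_succ m)
    have h5 : (ρ ^ m) ^ (1 - p) * (ρ ^ m) ^ p = ρ ^ m := by
      rw [← Real.rpow_add hρm]; simp
    calc _ = (a * (1 - ρ) * ρ ^ m) ^ (1 - p) * (A * (((n : ℝ) * 2 ^ (m + 1)) *
          (T / (n * 2 ^ (m + 1))) ^ (p * h))) := by ring
      _ ≤ ((1 - ρ) ^ (1 - p) * (ρ ^ m) ^ (1 - p)) *
          (A * (T ^ (p * h) * (n : ℝ) ^ (1 - p * h) * (ρ ^ m) ^ p)) := by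
        rw [h2]; gcongr
      _ = A * T ^ (p * h) * (1 - ρ) ^ (1 - p) * (n : ℝ) ^ (1 - p * h) *
          ((ρ ^ m) ^ (1 - p) * (ρ ^ m) ^ p) := by ring
      _ = _ := by rw [h5]
  refine (Finset.sum_le_sum fun m _ => hterm m).trans ?_
  rw [← Finset.mul_sum]
  have hgeom : ∑ m ∈ Finset.range N, ρ ^ m ≤ (1 - ρ)⁻¹ := by
    rw [← one_div, le_div_iff₀ hs, geom_sum_mul_neg]
    have : 0 ≤ ρ ^ N := by positivity
    linarith
  calc _ ≤ A * T ^ (p * h) * (1 - ρ) ^ (1 - p) * (n : ℝ) ^ (1 - p * h) * (1 - ρ)⁻¹ := by gcongr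
    _ = _ := by ring

/-- The maximal inequality for the uniform partition into `n` cells. -/
lemma ConditionalIncrementControl.measure_iSup_le_partition {Ω E : Type*} {mΩ : MeasurableSpace Ω}
    [NormedAddCommGroup E] [NormedSpace ℝ E] [CompleteSpace E]
    {μ : Measure Ω} [IsProbabilityMeasure μ] {ℱ : Filtration ℝ≥0 mΩ} {T : ℝ≥0}
    {X : ℝ≥0 → Ω → E} {p h A α C₁ C₂ ρ lam : ℝ}
    (hX : ConditionalIncrementControl μ ℱ T X p h A) (hp : 1 ≤ p) (hA : 0 ≤ A) (hT : 0 < T)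
    (hdecay : UniformExpMarginalDecay μ T X α C₁ C₂) (hα : 0 < α) (hC₁ : 0 < C₁) (hC₂ : 0 ≤ C₂)
    (hρ0 : 0 < ρ) (hρ1 : ρ < 1) (hρ : ρ ^ p = 2 ^ (1 - p * h)) (hlam : 8 ≤ lam)
    {n : ℕ} (hn : 0 < n) :
    μ {ω | ENNReal.ofReal lam ≤ ⨆ t ∈ Set.Icc (0 : ℝ≥0) T, ‖X t ω‖ₑ} ≤
      ENNReal.ofReal ((n + 1) *
        ((C₂ * ∫ t in Set.Ioi (0 : ℝ), Real.exp (-(C₁ / 2) * t ^ α)) *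
          Real.exp (-(C₁ / 2) * (lam / 2) ^ α)) +
        A * (T : ℝ) ^ (p * h) * ((1 - ρ) ^ (1 - p) * (1 - ρ)⁻¹) * (n : ℝ) ^ (1 - p * h)) := by
  have hs : 0 < 1 - ρ := by linarith
  -- Budget: `lam / 2` for truncation, `lam / 8` for the weights, `lam / 4` for Doob, in total
  -- strictly below `lam`. As `8 ≤ lam`, the weight prefactor is at least `1` and dividing by `lam /
  -- 4` can be dropped.
  set w : ℕ → ℝ := fun m => lam / 8 * (1 - ρ) * ρ ^ m with hwdef
  have hw : ∀ m, 0 < w m := fun m => by positivity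
  refine hX.measure_iSup_le hT hn (r := lam / 2 + lam / 8 + lam / 4) (by linarith) (by linarith)
    fun N => ?_
  refine (hX.measure_grid_le hp hA hT hn hw
    (sum_range_mul_one_sub_mul_pow_le hρ0.le (by linarith)) (by linarith) N).trans
    (ENNReal.ofReal_le_ofReal ?_)
  refine (div_le_self (integral_nonneg (chainingError_nonneg hw n N)) (by linarith)).trans ?_
  refine (hX.integral_chainingError_le hp hA hT hn hw (fun t ht => integral_max_norm_sub_le
    (hX.integrable hp ht) hα hC₁ hC₂ (fun r hr => hdecay r hr t ht) (by linarith)) N).trans ?_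
  gcongr
  exact sum_weight_mul_le hp hA T.coe_nonneg (by linarith) hρ0 hρ1 hρ hn N

/-! ### Choice of the number of cells. -/

lemma tendsto_rpow_mul_exp_neg_mul_rpow_atTop {s κ α : ℝ} (hκ : 0 < κ) (hα : 0 < α) :
    Filter.Tendsto (fun x : ℝ => x ^ s * Real.exp (-κ * x ^ α)) Filter.atTop (nhds 0) := by
  refine ((tendsto_rpow_mul_exp_neg_mul_atTop_nhds_zero (s / α) κ hκ).comp
    (tendsto_rpow_atTop hα)).congr' ?_
  filter_upwards [Filter.eventually_ge_atTop 0] with x hx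
  simp only [Function.comp_apply]
  rw [← Real.rpow_mul hx, mul_div_cancel₀ _ hα.ne']

theorem theorem2 (p h α C₁ C₂ A : ℝ) (hp : 1 < p) (hh : 0 < h) (hh1 : h ≤ 1) (hph : 1 < p * h)
    (hα : 0 < α) (hC₁ : 0 < C₁) (hC₂ : 0 < C₂) (hA : 0 ≤ A) :
    ∃ C : ℝ, 0 < C ∧ ∀ T : ℝ≥0, 0 < T → ∃ lam₀ : ℝ, 0 < lam₀ ∧
      ∀ (d : ℕ) (Ω : Type*) (mΩ : MeasurableSpace Ω) (μ : Measure Ω) (_ : IsProbabilityMeasure μ)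
        (ℱ : Filtration ℝ≥0 mΩ) (X : ℝ≥0 → Ω → EuclideanSpace ℝ (Fin d)),
        UsualConditions μ ℱ →
        ConditionalIncrementControl μ ℱ T X p h A →
        UniformExpMarginalDecay μ T X α C₁ C₂ →
        ∀ lam : ℝ, lam₀ ≤ lam →
          μ.real {ω | ENNReal.ofReal lam ≤ ⨆ t ∈ Set.Icc (0 : ℝ≥0) T, ‖X t ω‖ₑ}
            ≤ C * lam ^ (-1 / h) *
              Real.exp (-(C₁ / (2 : ℝ) ^ (α + 2)) * (1 - 1 / (p * h)) * lam ^ α) := by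
  refine ⟨1, one_pos, fun T hT => ?_⟩
  have hph0 : 0 < p * h := by linarith
  set ρ : ℝ := (2 ^ (1 - p * h)) ^ p⁻¹ with hρdef
  have hρ0 : 0 < ρ := by positivity
  have hρ1 : ρ < 1 := Real.rpow_lt_one (by positivity)
    (Real.rpow_lt_one_of_one_lt_of_neg one_lt_two (by linarith)) (by positivity)
  have hρ : ρ ^ p = 2 ^ (1 - p * h) := Real.rpow_inv_rpow (by positivity) (by linarith)
  set K : ℝ := C₂ * ∫ t in Set.Ioi (0 : ℝ), Real.exp (-(C₁ / 2) * t ^ α) with hK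
  have hK0 : 0 ≤ K :=
    mul_nonneg hC₂.le (setIntegral_nonneg measurableSet_Ioi fun t _ => (Real.exp_pos _).le)
  set L : ℝ := A * (T : ℝ) ^ (p * h) * ((1 - ρ) ^ (1 - p) * (1 - ρ)⁻¹) with hL
  have hL0 : 0 ≤ L := by
    have : 0 < 1 - ρ := by linarith
    positivity
  set b : ℝ := C₁ / 2 ^ (α + 2) with hb
  have hb0 : 0 < b := by positivity
  -- The factor `2` is the spare rate that makes `C = 1` possible.
  have hb2 : ∀ lam : ℝ, 0 ≤ lam → C₁ / 2 * (lam / 2) ^ α = 2 * b * lam ^ α := by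
    intro lam hlam
    rw [hb, Real.div_rpow hlam two_pos.le, Real.rpow_add two_pos, Real.rpow_ofNat]
    ring
  set θ : ℝ := 1 - 1 / (p * h) with hθ
  have hθ0 : 0 < θ := by
    have : 1 / (p * h) < 1 := (div_lt_one hph0).2 hph
    linarith
  have hlim : Filter.Tendsto (fun x : ℝ => (3 * K + L) * (x ^ (1 / h) * Real.exp (-(b * θ) * x ^ α)))
      Filter.atTop (nhds 0) := by
    simpa using (tendsto_rpow_mul_exp_neg_mul_rpow_atTop (s := 1 / h) (mul_pos hb0 hθ0)
      hα).const_mul (3 * K + L)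
  obtain ⟨lam₁, hlam₁⟩ := Filter.eventually_atTop.1 (hlim.eventually (ge_mem_nhds one_pos))
  refine ⟨max lam₁ 8, by positivity, fun d Ω mΩ μ _ ℱ X _ hX hdecay lam hlam => ?_⟩
  have hlam8 : 8 ≤ lam := (le_max_right _ _).trans hlam
  have hlam0 : 0 < lam := by linarith
  set x : ℝ := lam ^ α with hx
  have hx0 : 0 ≤ x := by positivity
  -- Solves `e * exp (-2 * b * x) = e ^ (1 - p * h)`; both sides equal `exp (-2 * b * θ * x)`.
  set e : ℝ := Real.exp (2 * b * x / (p * h)) with he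
  have he1 : 1 ≤ e := Real.one_le_exp (by positivity)
  set n : ℕ := ⌈e⌉₊ with hn
  have hn0 : 0 < n := Nat.ceil_pos.2 (by linarith)
  have hne : e ≤ n := Nat.le_ceil e
  have hne' : (n : ℝ) < e + 1 := Nat.ceil_lt_add_one (by linarith)
  have hmain := hX.measure_iSup_le_partition hp.le hA hT hdecay hα hC₁ hC₂.le hρ0 hρ1 hρ hlam8 hn0
  rw [← hK, ← hL, neg_mul, hb2 lam hlam0.le, ← hx] at hmain
  have h1 : ((n : ℝ) + 1) * (K * Real.exp (-(2 * b * x))) ≤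
      3 * K * Real.exp (-(2 * b * θ * x)) := by
    have h2 : Real.exp (-(2 * b * θ * x)) = e * Real.exp (-(2 * b * x)) := by
      rw [he, ← Real.exp_add, hθ]; congr 1; ring
    rw [h2]
    calc _ ≤ (3 * e) * (K * Real.exp (-(2 * b * x))) := by gcongr; linarith
      _ = _ := by ring
  have h3 : (n : ℝ) ^ (1 - p * h) ≤ Real.exp (-(2 * b * θ * x)) := by
    refine (Real.rpow_le_rpow_of_nonpos (by linarith) hne (by linarith)).trans (le_of_eq ?_)
    rw [he, ← Real.exp_mul, hθ]
    congr 1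
    field_simp
    ring
  have h4 : Real.exp (-(2 * b * θ * x)) = Real.exp (-(b * θ) * x) * Real.exp (-b * θ * x) := by
    rw [← Real.exp_add]; congr 1; ring
  have h5 : (3 * K + L) * (lam ^ (1 / h) * Real.exp (-(b * θ) * x)) ≤ 1 :=
    hlam₁ lam ((le_max_left _ _).trans hlam)
  have h6 : (3 * K + L) * Real.exp (-(b * θ) * x) ≤ lam ^ (-1 / h) := by
    rw [neg_div, Real.rpow_neg hlam0.le, ← one_div (lam ^ (1 / h)), le_div_iff₀ (by positivity)]
    linarith
  refine ENNReal.toReal_le_of_le_ofReal (by positivity)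
    (hmain.trans (ENNReal.ofReal_le_ofReal ?_))
  calc _ ≤ 3 * K * Real.exp (-(2 * b * θ * x)) + L * Real.exp (-(2 * b * θ * x)) := by gcongr
    _ = (3 * K + L) * Real.exp (-(b * θ) * x) * Real.exp (-b * θ * x) := by rw [h4]; ring
    _ ≤ 1 * lam ^ (-1 / h) * Real.exp (-b * θ * x) := by rw [one_mul]; gcongr
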